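/- There are universal constants $c, C, \gamma_1, \gamma_2, \gamma_3, \gamma_4 > 0$ such that the following holds for all integers $n, k$ with $1 \le k \le n/16$, every fixed index $i^* \in \{1,\dots,n\}$, and every random $n \times k$ matrix $\tilde V$ with i.i.d. $N(0,1)$ entries and columns $\tilde v_1,\dots,\tilde v_k$. With failure probability at most $\gamma_1 e^{-\gamma_2 n} + \gamma_3 e^{-\gamma_4 k}$, all of the following hold simultaneously: (1) The minimum of $\|\tilde V \tilde x\|_1$ over all $\tilde x \in \mathbb{R}^k$ with $(\tilde V \tilde x)(i^*) = 1$ is attained and $$ c\,\frac{n}{\sqrt k} \;\le\; \min\{\|\tilde V \tilde x\|_1 : (\tilde V\tilde x)(i^*) = 1\} \;\le\; C\,\frac{n}{\sqrt k}. $$ (2) For every nonzero $v \in \mathbb{R}^n$ with $|v(i^*)| = \|v\|_\infty$: if $v/v(i^*)$ minimizes $\|z\|_1$ subject to $z \in \mathrm{span}\{v, \tilde v_1, \dots, \tilde v_k\}$ and $z(i^*) = 1$, then $\|v\|_1/\|v\|_\infty \le C n/\sqrt k$. (3) For every nonzero $v \in \mathbb{R}^n$: if $v$ minimizes $\|z\|_1/\|z\|_\infty$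 over all nonzero $z \in \mathrm{span}\{v, \tilde v_1, \dots, \tilde v_k\}$, then $\|v\|_1/\|v\|_\infty \le C n/\sqrt k$. -/

import Mathlib

open MeasureTheory ProbabilityTheory

namespace SparsestElement

/-- The `ℓ₁` norm of a vector. -/
def l1Norm {n : ℕ} (z : Fin n → ℝ) : ℝ := ∑ l, |z l|

/-- The ratio `‖z‖₁ / ‖z‖_∞` (the norm of the type `Fin n → ℝ` is the sup norm); it is only
used for `z ≠ 0`. -/
noncomputable def l1LinfRatio {n : ℕ} (z : Fin n → ℝ) : ℝ := l1Norm z / ‖z‖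

/-- A random `n × k` matrix with i.i.d. `N(0,1)` entries. -/
structure IsStdGaussianMatrix {Ω : Type*} [MeasurableSpace Ω] {n k : ℕ}
    (V : Ω → Matrix (Fin n) (Fin k) ℝ) (μ : Measure Ω) : Prop where
  hasLaw_entry : ∀ l j, HasLaw (fun ω => V ω l j) (gaussianReal 0 1) μ
  indep_entries : iIndepFun (fun (p : Fin n × Fin k) (ω : Ω) => V ω p.1 p.2) μ

/-- The subspace spanned by `v` and the columns of `A`. -/
def plantedSubspace {n k : ℕ} (v : Fin n → ℝ) (A : Matrix (Fin n) (Fin k) ℝ) :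
    Submodule ℝ (Fin n → ℝ) :=
  Submodule.span ℝ (insert v (Set.range fun (j : Fin k) (l : Fin n) => A l j))

/-- `z` solves the linear program: minimize `‖z‖₁` such that `z ∈ W` and `z(i) = 1`. -/
def SolvesProgram {n : ℕ} (W : Submodule ℝ (Fin n → ℝ)) (i : Fin n) (z : Fin n → ℝ) : Prop :=
  (z ∈ W ∧ z i = 1) ∧ ∀ y ∈ W, y i = 1 → l1Norm z ≤ l1Norm y

/-- `z` solves the problem: minimize `‖z‖₁ / ‖z‖_∞` such that `z ∈ W` and `z ≠ 0`. -/
def MinimizesRatio {n : ℕ} (W : Submodule ℝ (Fin n → ℝ)) (z : Fin n → ℝ) : Prop :=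
  (z ∈ W ∧ z ≠ 0) ∧ ∀ y ∈ W, y ≠ 0 → l1LinfRatio z ≤ l1LinfRatio y

/-- `m` is the (attained) minimum of `‖A x‖₁` subject to `(A x)(i) = 1`. -/
def IsProgramMin {n k : ℕ} (A : Matrix (Fin n) (Fin k) ℝ) (i : Fin n) (m : ℝ) : Prop :=
  IsLeast {t : ℝ | ∃ x : Fin k → ℝ, A.mulVec x i = 1 ∧ t = l1Norm (A.mulVec x)} m

end SparsestElement

/-!
For a fixed unit vector `x`, the entries of `V x` are independent standard Gaussians, so Chernoff's
bound gives `‖V x‖₁ ≍ n` outside an event of probability `2 * exp (-3 * n)`. A net of the unit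
sphere of `ℝ^k` with constant mesh has at most `exp (16 * k) ≤ exp n` points, so with high
probability this holds on the whole net, and hence `‖V x‖₁ ≍ n * ‖x‖₂` for all `x` by linearity.

The constraint `(V x) i = 1` says `⟪V i, x⟫ = 1`, and the row `V i` has norm of order `√k`. The
minimum is therefore of order `n / √k`: Cauchy–Schwarz gives the lower bound, and the feasible point
`V i / ‖V i‖²` the upper bound. A minimizer of the program for `V` also lies in every planted
subspace, where it competes with the planted vector.
-/

namespace SparsestElement

section Chernoff

variable {Ω ι : Type*} [MeasurableSpace Ω] [Fintype ι] {μ : Measure Ω}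

lemma measureReal_mul_card_le_sum_le {X : ι → Ω → ℝ} {t M : ℝ} (hX : iIndepFun X μ)
    (hX_meas : ∀ i, AEMeasurable (X i) μ) (ht : 0 ≤ t) (hpos : ∀ i, 0 < mgf (X i) μ t)
    (hle : ∀ i, mgf (X i) μ t ≤ M) (s : ℝ) :
    μ.real {ω | s * Fintype.card ι ≤ ∑ i, X i ω} ≤
      (Real.exp (-(t * s)) * M) ^ Fintype.card ι := by
  have := hX.isProbabilityMeasure
  have hmgf : mgf (∑ i, X i) μ t = ∏ i, mgf (X i) μ t := hX.mgf_sum₀ hX_meas Finset.univ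
  have hint : Integrable (fun ω => Real.exp (t * (∑ i, X i) ω)) μ :=
    mgf_pos_iff.1 (hmgf ▸ Finset.prod_pos fun i _ => hpos i)
  have hprod : ∏ i, mgf (X i) μ t ≤ M ^ Fintype.card ι :=
    (Finset.prod_le_prod (fun i _ => (hpos i).le) fun i _ => hle i).trans_eq (by simp)
  calc μ.real {ω | s * Fintype.card ι ≤ ∑ i, X i ω}
      = μ.real {ω | s * Fintype.card ι ≤ (∑ i, X i) ω} := by simp only [Finset.sum_apply]
    _ ≤ Real.exp (-t * (s * Fintype.card ι)) * mgf (∑ i, X i) μ t :=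
        measure_ge_le_exp_mul_mgf _ ht hint
    _ ≤ Real.exp (-t * (s * Fintype.card ι)) * M ^ Fintype.card ι := by
        rw [hmgf]; gcongr
    _ = (Real.exp (-(t * s)) * M) ^ Fintype.card ι := by
        rw [mul_pow, ← Real.exp_nat_mul]; ring_nf

end Chernoff

section GaussianMgf

open scoped NNReal

variable {v : ℝ≥0} {t : ℝ}

lemma gaussianPDFReal_le (m : ℝ) (v : ℝ≥0) (x : ℝ) :
    gaussianPDFReal m v x ≤ (√(2 * Real.pi * v))⁻¹ := by
  rw [gaussianPDFReal]
  refine mul_le_of_le_one_right (by positivity) (Real.exp_le_one_iff.2 ?_)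
  exact div_nonpos_of_nonpos_of_nonneg (neg_nonpos.2 (sq_nonneg _)) (by positivity)

lemma integral_exp_neg_mul_abs (ht : 0 < t) : ∫ x : ℝ, Real.exp (-(t * |x|)) = 2 / t := by
  have h := integral_comp_abs (f := fun x => Real.exp (-t * x))
  rw [integral_exp_mul_Ioi (neg_lt_zero.2 ht)] at h
  simp only [neg_mul, mul_zero, Real.exp_zero] at h
  rw [h, neg_div_neg_eq, mul_one_div]

lemma integrable_exp_neg_mul_abs (ht : 0 < t) :
    Integrable fun x : ℝ => Real.exp (-(t * |x|)) :=
  Integrable.of_integral_ne_zero <| by rw [integral_exp_neg_mul_abs ht]; positivity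

lemma mgf_neg_abs_gaussianReal_le (m : ℝ) (hv : v ≠ 0) (ht : 0 < t) :
    mgf (fun x => -|x|) (gaussianReal m v) t ≤ 2 / (t * √(2 * Real.pi * v)) := by
  rw [mgf, integral_gaussianReal_eq_integral_smul hv]
  simp only [smul_eq_mul, mul_neg]
  calc ∫ x, gaussianPDFReal m v x * Real.exp (-(t * |x|))
      ≤ ∫ x, (√(2 * Real.pi * v))⁻¹ * Real.exp (-(t * |x|)) := by
        refine integral_mono_of_nonneg (.of_forall fun x => ?_)
          ((integrable_exp_neg_mul_abs ht).const_mul _) (.of_forall fun x => ?_)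
        · exact mul_nonneg (gaussianPDFReal_nonneg _ _ _) (Real.exp_nonneg _)
        · exact mul_le_mul_of_nonneg_right (gaussianPDFReal_le m v x) (Real.exp_nonneg _)
    _ = 2 / (t * √(2 * Real.pi * v)) := by
        rw [integral_const_mul, integral_exp_neg_mul_abs ht, inv_mul_eq_div, div_div]

lemma mgf_neg_abs_pos {ν : Measure ℝ} [IsProbabilityMeasure ν] (ht : 0 ≤ t) :
    0 < mgf (fun x => -|x|) ν t :=
  mgf_pos <| integrable_exp_mul_of_le t 0 ht (by fun_prop) <| .of_forall fun x => by simp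

lemma mgf_sq_gaussianReal (ht : 2 * v * t < 1) :
    mgf (fun x => x ^ 2) (gaussianReal 0 v) t = (√(1 - 2 * v * t))⁻¹ := by
  rcases eq_or_ne v 0 with rfl | hv
  · simp [mgf]
  have : (0 : ℝ) < v := by positivity
  have hdensity (x : ℝ) : gaussianPDFReal 0 v x • Real.exp (t * x ^ 2) =
      (√(2 * Real.pi * v))⁻¹ * Real.exp (-((1 - 2 * v * t) / (2 * v)) * x ^ 2) := by
    rw [gaussianPDFReal, smul_eq_mul, mul_assoc, ← Real.exp_add]
    congr 2
    field_simp
    ring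
  rw [mgf, integral_gaussianReal_eq_integral_smul hv]
  simp_rw [hdensity]
  rw [integral_const_mul, integral_gaussian, ← Real.sqrt_inv, ← Real.sqrt_mul (by positivity),
    ← Real.sqrt_inv]
  congr 1
  have : 1 - 2 * (v * t) ≠ 0 := by linarith
  field_simp

end GaussianMgf

/-- The vector `y` has the `ℓ₁` and `ℓ₂` norms of a typical standard Gaussian vector. The constants
are chosen so that the exceptional probability is at most `2 * exp (-3 * d)` in dimension `d`. -/
structure HasGaussianNorms {ι : Type*} [Fintype ι] (y : ι → ℝ) : Prop where
  lt_sum_abs : Fintype.card ι / 200 < ∑ i, |y i|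
  sum_sq_lt : ∑ i, y i ^ 2 < 16 * Fintype.card ι

namespace HasGaussianNorms

variable {ι : Type*} [Fintype ι] {y : ι → ℝ}

lemma ne_zero (hy : HasGaussianNorms y) : y ≠ 0 := by
  rintro rfl
  have hlt := hy.lt_sum_abs
  simp only [Pi.zero_apply, abs_zero, Finset.sum_const_zero] at hlt
  exact hlt.not_ge (by positivity)

lemma sum_abs_le (hy : HasGaussianNorms y) : ∑ i, |y i| ≤ 4 * Fintype.card ι := by
  refine le_of_sq_le_sq ?_ (by positivity)
  calc (∑ i, |y i|) ^ 2 ≤ Fintype.card ι * ∑ i, |y i| ^ 2 := sq_sum_le_card_mul_sum_sq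
    _ ≤ Fintype.card ι * (16 * Fintype.card ι) := by
      simp only [sq_abs]
      gcongr
      exact hy.sum_sq_lt.le
    _ = (4 * Fintype.card ι) ^ 2 := by ring

lemma norm_toLp_le (hy : HasGaussianNorms y) :
    ‖WithLp.toLp 2 y‖ ≤ 4 * √(Fintype.card ι) := by
  refine le_of_sq_le_sq ?_ (by positivity)
  rw [EuclideanSpace.real_norm_sq_eq, mul_pow, Real.sq_sqrt (Nat.cast_nonneg _)]
  linarith [hy.sum_sq_lt]

lemma le_norm_toLp (hy : HasGaussianNorms y) :
    √(Fintype.card ι) / 200 ≤ ‖WithLp.toLp 2 y‖ := by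
  have hcs : ∑ i, |y i| ≤ √(Fintype.card ι) * ‖WithLp.toLp 2 y‖ := by
    rw [EuclideanSpace.norm_eq, ← Real.sqrt_mul (Nat.cast_nonneg _)]
    exact Real.le_sqrt_of_sq_le (by
      simpa using sq_sum_le_card_mul_sum_sq (s := Finset.univ) (f := fun i => |y i|))
  rcases (Real.sqrt_nonneg (Fintype.card ι)).eq_or_lt with h0 | hpos
  · rw [← h0, zero_div]; exact norm_nonneg _
  refine le_of_mul_le_mul_left ?_ hpos
  calc √(Fintype.card ι) * (√(Fintype.card ι) / 200) = Fintype.card ι / 200 := by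
        rw [← mul_div_assoc, Real.mul_self_sqrt (Nat.cast_nonneg _)]
    _ ≤ ∑ i, |y i| := hy.lt_sum_abs.le
    _ ≤ √(Fintype.card ι) * ‖WithLp.toLp 2 y‖ := hcs

end HasGaussianNorms

section GaussianNorms

variable {Ω ι : Type*} [MeasurableSpace Ω] [Fintype ι] {μ : Measure Ω} {Z : ι → Ω → ℝ}

lemma measureReal_sum_abs_le (hZ : iIndepFun Z μ) (hlaw : ∀ i, HasLaw (Z i) (gaussianReal 0 1) μ) :
    μ.real {ω | ∑ i, |Z i ω| ≤ Fintype.card ι / 200} ≤ Real.exp (-3 * Fintype.card ι) := by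
  have hmgf (i : ι) : mgf (fun ω => -|Z i ω|) μ 200 =
      mgf (fun x => -|x|) (gaussianReal 0 1) 200 := by
    rw [← (hlaw i).map_eq, mgf_map (hlaw i).aemeasurable (by fun_prop)]; rfl
  have hle : mgf (fun x => -|x|) (gaussianReal 0 1) 200 ≤ 1 / 200 := by
    refine (mgf_neg_abs_gaussianReal_le 0 one_ne_zero (by norm_num)).trans ?_
    have hpi : 2 ≤ √(2 * Real.pi * (1 : NNReal)) :=
      Real.le_sqrt_of_sq_le (by push_cast; linarith [Real.pi_gt_three])
    rw [div_le_div_iff₀ (by positivity) (by norm_num)]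
    linarith
  have hbase : Real.exp (-(200 * (-1 / 200))) * (1 / 200) ≤ Real.exp (-3) := by
    have h4 : Real.exp 4 ≤ 200 :=
      calc Real.exp 4 = Real.exp 1 ^ 4 := by rw [Real.exp_one_pow]; norm_num
        _ ≤ 3 ^ 4 := by gcongr; exact Real.exp_one_lt_three.le
        _ ≤ 200 := by norm_num
    calc Real.exp (-(200 * (-1 / 200))) * (1 / 200) = Real.exp (-3) * Real.exp 4 / 200 := by
          rw [← Real.exp_add]; norm_num; ring_nf
      _ ≤ Real.exp (-3) := by
          rw [div_le_iff₀ (by norm_num)]; gcongr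
  calc μ.real {ω | ∑ i, |Z i ω| ≤ Fintype.card ι / 200}
      = μ.real {ω | -1 / 200 * Fintype.card ι ≤ ∑ i, -|Z i ω|} := by
        congr 1; ext ω
        simp only [Set.mem_ofPred_eq, Finset.sum_neg_distrib]
        constructor <;> intro h <;> linarith
    _ ≤ (Real.exp (-(200 * (-1 / 200))) * (1 / 200)) ^ Fintype.card ι :=
        measureReal_mul_card_le_sum_le (hZ.comp (fun _ x => -|x|) fun _ => by fun_prop)
          (fun i => (hlaw i).aemeasurable.abs.neg) (by norm_num)
          (fun i => (hmgf i).symm ▸ mgf_neg_abs_pos (by norm_num))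
          (fun i => (hmgf i).trans_le hle) _
    _ ≤ Real.exp (-3) ^ Fintype.card ι := by gcongr
    _ = Real.exp (-3 * Fintype.card ι) := by rw [← Real.exp_nat_mul, mul_comm]

lemma measureReal_le_sum_sq (hZ : iIndepFun Z μ) (hlaw : ∀ i, HasLaw (Z i) (gaussianReal 0 1) μ) :
    μ.real {ω | 16 * Fintype.card ι ≤ ∑ i, Z i ω ^ 2} ≤ Real.exp (-3 * Fintype.card ι) := by
  have hmgf (i : ι) : mgf (fun ω => Z i ω ^ 2) μ (1 / 4) = √2 := by
    have h := mgf_sq_gaussianReal (v := 1) (t := 1 / 4) (by norm_num)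
    rw [← (hlaw i).map_eq, mgf_map (hlaw i).aemeasurable (by fun_prop)] at h
    refine h.trans ?_
    rw [← Real.sqrt_inv]; norm_num
  have hbase : Real.exp (-(1 / 4 * 16)) * √2 ≤ Real.exp (-3) := by
    have h2 : √2 ≤ Real.exp 1 :=
      (Real.sqrt_le_iff.2 ⟨zero_le_two, by norm_num⟩).trans
        (by linarith [Real.add_one_le_exp 1])
    calc Real.exp (-(1 / 4 * 16)) * √2 ≤ Real.exp (-(1 / 4 * 16)) * Real.exp 1 := by gcongr
      _ = Real.exp (-3) := by rw [← Real.exp_add]; norm_num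
  calc μ.real {ω | 16 * Fintype.card ι ≤ ∑ i, Z i ω ^ 2}
      ≤ (Real.exp (-(1 / 4 * 16)) * √2) ^ Fintype.card ι :=
        measureReal_mul_card_le_sum_le (hZ.comp (fun _ x => x ^ 2) fun _ => by fun_prop)
          (fun i => (hlaw i).aemeasurable.pow_const 2) (by norm_num)
          (fun i => (Real.sqrt_pos.2 two_pos).trans_eq (hmgf i).symm)
          (fun i => (hmgf i).le) 16
    _ ≤ Real.exp (-3) ^ Fintype.card ι := by gcongr
    _ = Real.exp (-3 * Fintype.card ι) := by rw [← Real.exp_nat_mul, mul_comm]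

lemma measureReal_not_hasGaussianNorms_le (hZ : iIndepFun Z μ)
    (hlaw : ∀ i, HasLaw (Z i) (gaussianReal 0 1) μ) :
    μ.real {ω | ¬ HasGaussianNorms fun i => Z i ω} ≤ 2 * Real.exp (-3 * Fintype.card ι) := by
  have := hZ.isProbabilityMeasure
  have hsub : {ω | ¬ HasGaussianNorms fun i => Z i ω} ⊆
      {ω | ∑ i, |Z i ω| ≤ Fintype.card ι / 200} ∪
        {ω | 16 * Fintype.card ι ≤ ∑ i, Z i ω ^ 2} := by
    intro ω hω
    by_contra! h
    simp only [Set.mem_union, Set.mem_ofPred_eq, not_or, not_le] at h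
    exact hω ⟨h.1, h.2⟩
  rw [two_mul]
  exact (measureReal_mono hsub).trans <| (measureReal_union_le _ _).trans <|
    add_le_add (measureReal_sum_abs_le hZ hlaw) (measureReal_le_sum_sq hZ hlaw)

end GaussianNorms

namespace IsStdGaussianMatrix

variable {Ω : Type*} [MeasurableSpace Ω] {μ : Measure Ω} {n k : ℕ}
  {V : Ω → Matrix (Fin n) (Fin k) ℝ}

lemma iIndepFun_row (hV : IsStdGaussianMatrix V μ) (i : Fin n) :
    iIndepFun (fun j ω => V ω i j) μ :=
  hV.indep_entries.precomp (Prod.mk_right_injective i)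

lemma memLp_two_entry (hV : IsStdGaussianMatrix V μ) (l : Fin n) (j : Fin k) :
    MemLp (fun ω => V ω l j) 2 μ :=
  (hV.hasLaw_entry l j).hasGaussianLaw.memLp_two

lemma covariance_entry (hV : IsStdGaussianMatrix V μ) (p q : Fin n × Fin k) :
    cov[fun ω => V ω p.1 p.2, fun ω => V ω q.1 q.2; μ] = if p = q then 1 else 0 := by
  split_ifs with h
  · subst h
    rw [covariance_self (hV.memLp_two_entry p.1 p.2).aemeasurable,
      (hV.hasLaw_entry p.1 p.2).variance_eq, variance_id_gaussianReal, NNReal.coe_one]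
  · exact (hV.indep_entries.indepFun h).covariance_eq_zero (hV.memLp_two_entry _ _)
      (hV.memLp_two_entry _ _)

lemma covariance_mulVec (hV : IsStdGaussianMatrix V μ) (x : Fin k → ℝ) (l m : Fin n) :
    cov[fun ω => (V ω).mulVec x l, fun ω => (V ω).mulVec x m; μ] =
      if l = m then ∑ j, x j ^ 2 else 0 := by
  have := hV.indep_entries.isProbabilityMeasure
  have hentry (j j' : Fin k) : cov[fun ω => V ω l j, fun ω => V ω m j'; μ] =
      if l = m ∧ j = j' then 1 else 0 := by
    simpa only [Prod.mk.injEq] using hV.covariance_entry (l, j) (m, j')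
  simp only [Matrix.mulVec, dotProduct]
  rw [covariance_fun_sum_fun_sum (fun j => (hV.memLp_two_entry l j).mul_const _)
    (fun j => (hV.memLp_two_entry m j).mul_const _)]
  simp_rw [covariance_mul_const_left, covariance_mul_const_right, hentry]
  split_ifs with hlm
  · simp [hlm, sq]
  · simp [hlm]

lemma integral_mulVec (hV : IsStdGaussianMatrix V μ) (x : Fin k → ℝ) (l : Fin n) :
    ∫ ω, (V ω).mulVec x l ∂μ = 0 := by
  simp only [Matrix.mulVec, dotProduct]
  rw [integral_finsetSum _ fun j _ =>
    (hV.hasLaw_entry l j).hasGaussianLaw.integrable.mul_const _]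
  refine Finset.sum_eq_zero fun j _ => ?_
  rw [integral_mul_const, (hV.hasLaw_entry l j).integral_eq, integral_id_gaussianReal, zero_mul]

lemma hasGaussianLaw_mulVec (hV : IsStdGaussianMatrix V μ) (x : Fin k → ℝ) :
    HasGaussianLaw (fun ω l => (V ω).mulVec x l) μ := by
  have hentries : HasGaussianLaw (fun ω (p : Fin n × Fin k) => V ω p.1 p.2) μ :=
    iIndepFun.hasGaussianLaw (fun p => (hV.hasLaw_entry p.1 p.2).hasGaussianLaw) hV.indep_entries
  let L : (Fin n × Fin k → ℝ) →L[ℝ] (Fin n → ℝ) :=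
    ContinuousLinearMap.pi fun l => ∑ j, x j • ContinuousLinearMap.proj (l, j)
  have hL : (fun ω l => (V ω).mulVec x l) = fun ω => L fun p => V ω p.1 p.2 := by
    ext ω l
    simp [L, Matrix.mulVec, dotProduct, mul_comm]
  exact hL ▸ hentries.map_fun L

lemma iIndepFun_mulVec (hV : IsStdGaussianMatrix V μ) (x : Fin k → ℝ) :
    iIndepFun (fun l ω => (V ω).mulVec x l) μ :=
  (hV.hasGaussianLaw_mulVec x).iIndepFun_of_covariance_eq_zero fun l m hlm => by
    rw [hV.covariance_mulVec, if_neg hlm]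

lemma hasLaw_mulVec (hV : IsStdGaussianMatrix V μ) (x : Fin k → ℝ) (l : Fin n) :
    HasLaw (fun ω => (V ω).mulVec x l) (gaussianReal 0 (∑ j, x j ^ 2).toNNReal) μ := by
  have hl := (hV.hasGaussianLaw_mulVec x).eval l
  refine ⟨hl.aemeasurable, ?_⟩
  rw [hl.map_eq_gaussianReal, hV.integral_mulVec, ← covariance_self hl.aemeasurable,
    hV.covariance_mulVec, if_pos rfl]

lemma measureReal_not_hasGaussianNorms_row_le (hV : IsStdGaussianMatrix V μ) (i : Fin n) :
    μ.real {ω | ¬ HasGaussianNorms (V ω i)} ≤ 2 * Real.exp (-3 * k) := by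
  simpa using measureReal_not_hasGaussianNorms_le (hV.iIndepFun_row i) (hV.hasLaw_entry i)

lemma measureReal_not_hasGaussianNorms_mulVec_le (hV : IsStdGaussianMatrix V μ)
    {x : EuclideanSpace ℝ (Fin k)} (hx : ‖x‖ = 1) :
    μ.real {ω | ¬ HasGaussianNorms ((V ω).mulVec x)} ≤ 2 * Real.exp (-3 * n) := by
  have hx' : ∑ j, x j ^ 2 = 1 := by rw [← EuclideanSpace.real_norm_sq_eq, hx, one_pow]
  simpa using measureReal_not_hasGaussianNorms_le (hV.iIndepFun_mulVec x) fun l => by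
    simpa only [hx', Real.toNNReal_one] using hV.hasLaw_mulVec x l

end IsStdGaussianMatrix

section Nets

open Metric Module
open scoped NNReal

variable {E : Type*} [NormedAddCommGroup E] [NormedSpace ℝ E] [FiniteDimensional ℝ E]
  {A : Set E} {x : E} {r ε : ℝ≥0}

lemma card_le_of_isSeparated (hε : 0 < ε) {s : Finset E} (hs : ↑s ⊆ closedBall x r)
    (hsep : IsSeparated ε (s : Set E)) : (s.card : ℝ) ≤ (1 + 2 * r / ε) ^ finrank ℝ E := by
  borelize E
  let μ : Measure E := Measure.addHaar
  have hε2 : (0 : ℝ) < ε / 2 := by positivity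
  have hball (y : E) {ρ : ℝ} (hρ : 0 < ρ) :
      μ.real (ball y ρ) = ρ ^ finrank ℝ E * μ.real (ball 0 1) := by
    rw [measureReal_def, μ.addHaar_ball_of_pos y hρ, ENNReal.toReal_mul,
      ENNReal.toReal_ofReal (by positivity), measureReal_def]
  have hunit : 0 < μ.real (ball 0 1) :=
    ENNReal.toReal_pos (measure_ball_pos _ _ zero_lt_one).ne' measure_ball_lt_top.ne
  have hdisj : (s : Set E).PairwiseDisjoint fun y => ball y (ε / 2 : ℝ) := by
    intro y hy z hz hyz
    refine ball_disjoint_ball ?_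
    have hlt : (ε : ENNReal) < edist y z := hsep hy hz hyz
    rw [edist_nndist, ENNReal.coe_lt_coe] at hlt
    rw [add_halves]
    exact_mod_cast hlt.le
  have hsub : ⋃ y ∈ s, ball y (ε / 2 : ℝ) ⊆ ball x (r + ε / 2) :=
    Set.iUnion₂_subset fun y hy => ball_subset_ball' <| by
      rw [add_comm]
      exact add_le_add_left (hs hy) _
  have hvol : s.card * (ε / 2 : ℝ) ^ finrank ℝ E * μ.real (ball 0 1) ≤
      (r + ε / 2 : ℝ) ^ finrank ℝ E * μ.real (ball 0 1) :=
    calc s.card * (ε / 2 : ℝ) ^ finrank ℝ E * μ.real (ball 0 1)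
        = μ.real (⋃ y ∈ s, ball y (ε / 2 : ℝ)) := by
          rw [measureReal_biUnion_finset hdisj (fun _ _ => measurableSet_ball)
            fun _ _ => measure_ball_lt_top.ne]
          simp only [hball _ hε2, Finset.sum_const, nsmul_eq_mul, mul_assoc]
      _ ≤ μ.real (ball x (r + ε / 2)) := measureReal_mono hsub measure_ball_lt_top.ne
      _ = (r + ε / 2 : ℝ) ^ finrank ℝ E * μ.real (ball 0 1) := hball x (by positivity)
  calc (s.card : ℝ) ≤ (r + ε / 2 : ℝ) ^ finrank ℝ E / (ε / 2 : ℝ) ^ finrank ℝ E :=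
        (le_div_iff₀ (by positivity)).2 (le_of_mul_le_mul_right hvol hunit)
    _ = (1 + 2 * r / ε) ^ finrank ℝ E := by
        rw [← div_pow]; congr 1; field_simp; ring

lemma packingNumber_le (hε : 0 < ε) (hA : A ⊆ closedBall x r) :
    packingNumber ε A ≤ ⌊(1 + 2 * r / ε : ℝ) ^ finrank ℝ E⌋₊ := by
  refine iSup_le fun C => iSup₂_le fun hCA hC => ?_
  by_contra! hlt
  obtain ⟨s, hsC, hs⟩ := Set.exists_subset_encard_eq (Order.add_one_le_of_lt hlt)
  have hfin : s.Finite := Set.finite_of_encard_eq_coe (k := _ + 1) (by exact_mod_cast hs)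
  lift s to Finset E using hfin
  rw [Set.encard_coe_eq_coe_finsetCard] at hs
  have hcard := card_le_of_isSeparated hε ((hsC.trans hCA).trans hA) (hC.subset hsC)
  exact (Nat.le_floor hcard).not_gt (Nat.lt_of_succ_le (by exact_mod_cast hs.ge))

lemma exists_finset_isCover_card_le (hε : 0 < ε) (hA : A ⊆ closedBall x r) :
    ∃ N : Finset E, ↑N ⊆ A ∧ IsCover ε A N ∧ (N.card : ℝ) ≤ (1 + 2 * r / ε) ^ finrank ℝ E := by
  have hpack := packingNumber_le hε hA
  have htop : packingNumber ε A ≠ ⊤ := (hpack.trans_lt (ENat.natCast_lt_top _)).ne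
  have hcard := encard_maximalSeparatedSet htop
  have hfin : (maximalSeparatedSet ε A).Finite := by
    rwa [← Set.encard_ne_top_iff, hcard]
  refine ⟨hfin.toFinset, ?_, ?_, card_le_of_isSeparated (x := x) hε ?_ ?_⟩ <;>
    rw [hfin.coe_toFinset]
  exacts [maximalSeparatedSet_subset, isCover_maximalSeparatedSet htop,
    maximalSeparatedSet_subset.trans hA, isSeparated_maximalSeparatedSet]

end Nets

section NetExtension

open Metric
open scoped NNReal

variable {E F : Type*} [NormedAddCommGroup E] [NormedSpace ℝ E] [NormedAddCommGroup F]
  [NormedSpace ℝ F] {N : Set E} {ε : ℝ≥0} {a b : ℝ}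

lemma norm_map_sub_le_of_isCover_sphere (hN : IsCover ε (sphere (0 : E) 1) N) (T : E →L[ℝ] F)
    {x : E} (hx : ‖x‖ = 1) : ∃ y ∈ N, ‖T x - T y‖ ≤ ‖T‖ * ε := by
  obtain ⟨y, hy, hxy⟩ := hN (mem_sphere_zero_iff_norm.2 hx)
  refine ⟨y, hy, ?_⟩
  have hdist : ‖x - y‖ ≤ ε := by
    rw [← dist_eq_norm]
    exact_mod_cast edist_le_coe.1 hxy
  rw [← map_sub]
  exact T.le_opNorm_of_le hdist

lemma opNorm_mul_one_sub_le_of_isCover_sphere {T : E →L[ℝ] F}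
    (hN : IsCover ε (sphere (0 : E) 1) N) (hb : 0 ≤ b) (hT : ∀ y ∈ N, ‖T y‖ ≤ b) :
    ‖T‖ * (1 - ε) ≤ b := by
  have hle : ‖T‖ ≤ b + ‖T‖ * ε := T.opNorm_le_of_unit_norm (by positivity) fun x hx => by
    obtain ⟨y, hy, hxy⟩ := norm_map_sub_le_of_isCover_sphere hN T hx
    linarith [norm_le_norm_add_norm_sub' (T x) (T y), hT y hy]
  linarith

lemma mul_norm_le_of_isCover_sphere {T : E →L[ℝ] F}
    (hN : IsCover ε (sphere (0 : E) 1) N) (hT : ∀ y ∈ N, a ≤ ‖T y‖) (x : E) :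
    (a - ‖T‖ * ε) * ‖x‖ ≤ ‖T x‖ := by
  rcases eq_or_ne x 0 with rfl | hx
  · simp
  have hunit : ‖‖x‖⁻¹ • x‖ = 1 := norm_smul_inv_norm (𝕜 := ℝ) hx
  obtain ⟨y, hy, hxy⟩ := norm_map_sub_le_of_isCover_sphere hN T hunit
  calc (a - ‖T‖ * ε) * ‖x‖ ≤ ‖T (‖x‖⁻¹ • x)‖ * ‖x‖ := by
        gcongr
        linarith [norm_le_norm_add_norm_sub (T (‖x‖⁻¹ • x)) (T y), hT y hy]
    _ = ‖T x‖ := by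
        rw [map_smul, norm_smul, norm_inv, norm_norm, mul_right_comm,
          inv_mul_cancel₀ (norm_ne_zero_iff.2 hx), one_mul]

end NetExtension

section ProgramMin

variable {n k : ℕ} {A : Matrix (Fin n) (Fin k) ℝ} {i : Fin n} {a b m : ℝ}

/-- The matrix `A` as a continuous linear map from `ℓ₂` to `ℓ₁`, so that the bounds relating
`l1Norm (A.mulVec x)` to the Euclidean norm of `x` become operator norm bounds. -/
noncomputable def mulVecL1 (A : Matrix (Fin n) (Fin k) ℝ) :
    EuclideanSpace ℝ (Fin k) →L[ℝ] PiLp 1 fun _ : Fin n => ℝ :=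
  LinearMap.toContinuousLinearMap
    ((WithLp.linearEquiv 1 ℝ (Fin n → ℝ)).symm.toLinearMap ∘ₗ A.mulVecLin ∘ₗ
      (WithLp.linearEquiv 2 ℝ (Fin k → ℝ)).toLinearMap)

lemma norm_mulVecL1 (A : Matrix (Fin n) (Fin k) ℝ) (x : EuclideanSpace ℝ (Fin k)) :
    ‖mulVecL1 A x‖ = l1Norm (A.mulVec x) := by
  simp [mulVecL1, PiLp.norm_eq_of_L1, l1Norm]

lemma mulVec_apply_eq_inner (A : Matrix (Fin n) (Fin k) ℝ) (i : Fin n)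
    (x : EuclideanSpace ℝ (Fin k)) : A.mulVec x i = inner ℝ (WithLp.toLp 2 (A i)) x := by
  simp [Matrix.mulVec, dotProduct, PiLp.inner_apply, mul_comm]

lemma mulVec_inv_norm_sq_smul_row (hrow : A i ≠ 0) :
    A.mulVec ((‖WithLp.toLp 2 (A i)‖ ^ 2)⁻¹ • WithLp.toLp 2 (A i)).ofLp i = 1 := by
  have hnorm : ‖WithLp.toLp 2 (A i)‖ ≠ 0 := by simpa using hrow
  rw [mulVec_apply_eq_inner, inner_smul_right, real_inner_self_eq_norm_sq,
    inv_mul_cancel₀ (pow_ne_zero 2 hnorm)]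

lemma exists_isProgramMin (ha : 0 < a) (hA : ∀ x, a * ‖x‖ ≤ ‖mulVecL1 A x‖) (hrow : A i ≠ 0) :
    ∃ m, IsProgramMin A i m := by
  have hcont : Continuous fun x => ‖mulVecL1 A x‖ := by fun_prop
  have hcoercive : Filter.Tendsto (fun x => ‖mulVecL1 A x‖) (Filter.cocompact _) Filter.atTop :=
    Filter.tendsto_atTop_mono hA (tendsto_norm_cocompact_atTop.const_mul_atTop ha)
  have hclosed : IsClosed {x : EuclideanSpace ℝ (Fin k) | A.mulVec x i = 1} := by
    simp only [mulVec_apply_eq_inner]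
    exact isClosed_eq (by fun_prop) continuous_const
  obtain ⟨x, hx, hmin⟩ := hcont.continuousOn.exists_isMinOn' hclosed
    (mulVec_inv_norm_sq_smul_row hrow)
    ((hcoercive.eventually_ge_atTop _).filter_mono inf_le_left)
  refine ⟨l1Norm (A.mulVec x), ⟨x, hx, rfl⟩, ?_⟩
  rintro _ ⟨y, hy, rfl⟩
  simpa only [Set.mem_ofPred_eq, norm_mulVecL1] using
    isMinOn_iff.1 hmin (WithLp.toLp 2 y) hy

namespace IsProgramMin

lemma div_norm_row_le (hm : IsProgramMin A i m) (ha : 0 ≤ a)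
    (hA : ∀ x, a * ‖x‖ ≤ ‖mulVecL1 A x‖) : a / ‖WithLp.toLp 2 (A i)‖ ≤ m := by
  obtain ⟨⟨x, hx, rfl⟩, -⟩ := hm
  have hcs : 1 ≤ ‖WithLp.toLp 2 (A i)‖ * ‖WithLp.toLp 2 x‖ := by
    rw [← hx, ← WithLp.ofLp_toLp 2 x, mulVec_apply_eq_inner]
    exact real_inner_le_norm _ _
  have hrow : 0 < ‖WithLp.toLp 2 (A i)‖ :=
    pos_of_mul_pos_left (zero_lt_one.trans_le hcs) (norm_nonneg _)
  calc a / ‖WithLp.toLp 2 (A i)‖ ≤ a * ‖WithLp.toLp 2 x‖ := by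
        rw [div_le_iff₀ hrow, mul_assoc, mul_comm ‖_‖]
        exact le_mul_of_one_le_right ha hcs
    _ ≤ ‖mulVecL1 A (WithLp.toLp 2 x)‖ := hA _
    _ = l1Norm (A.mulVec x) := norm_mulVecL1 _ _

lemma le_div_norm_row (hm : IsProgramMin A i m) (hrow : A i ≠ 0)
    (hA : ∀ x, ‖mulVecL1 A x‖ ≤ b * ‖x‖) : m ≤ b / ‖WithLp.toLp 2 (A i)‖ := by
  have hnorm : ‖WithLp.toLp 2 (A i)‖ ≠ 0 := by simpa using hrow
  refine (hm.2 ⟨_, mulVec_inv_norm_sq_smul_row hrow, rfl⟩).trans ?_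
  rw [← norm_mulVecL1]
  refine (hA _).trans_eq ?_
  rw [norm_smul, norm_inv, norm_pow, norm_norm]
  field_simp

end IsProgramMin

lemma mulVec_mem_plantedSubspace (v : Fin n → ℝ) (A : Matrix (Fin n) (Fin k) ℝ)
    (x : Fin k → ℝ) : A.mulVec x ∈ plantedSubspace v A := by
  have hspan : A.mulVec x ∈ Submodule.span ℝ (Set.range A.col) :=
    A.range_mulVecLin ▸ LinearMap.mem_range_self A.mulVecLin x
  exact Submodule.span_mono (Set.subset_insert _ _) hspan

lemma l1LinfRatio_eq_l1Norm_inv_smul {v : Fin n → ℝ} (hv : ∀ l, |v l| ≤ |v i|) :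
    l1LinfRatio v = l1Norm ((v i)⁻¹ • v) := by
  have hnorm : ‖v‖ = |v i| :=
    le_antisymm ((pi_norm_le_iff_of_nonneg (abs_nonneg _)).2 hv) (norm_le_pi_norm v i)
  simp [l1LinfRatio, l1Norm, hnorm, abs_mul, ← Finset.mul_sum, div_eq_inv_mul]

lemma l1LinfRatio_le_l1Norm {y : Fin n → ℝ} (hy : y i = 1) : l1LinfRatio y ≤ l1Norm y := by
  have hnorm : 1 ≤ ‖y‖ := by simpa [hy] using norm_le_pi_norm y i
  exact div_le_self (Finset.sum_nonneg fun _ _ => abs_nonneg _) hnorm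

namespace IsProgramMin

lemma l1LinfRatio_le_of_solvesProgram (hm : IsProgramMin A i m) {v : Fin n → ℝ}
    (hv : ∀ l, |v l| ≤ |v i|)
    (h : SolvesProgram (plantedSubspace v A) i ((v i)⁻¹ • v)) : l1LinfRatio v ≤ m := by
  obtain ⟨⟨x, hx, rfl⟩, -⟩ := hm
  rw [l1LinfRatio_eq_l1Norm_inv_smul hv]
  exact h.2 _ (mulVec_mem_plantedSubspace v A x) hx

lemma l1LinfRatio_le_of_minimizesRatio (hm : IsProgramMin A i m) {v : Fin n → ℝ}
    (h : MinimizesRatio (plantedSubspace v A) v) : l1LinfRatio v ≤ m := by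
  obtain ⟨⟨x, hx, rfl⟩, -⟩ := hm
  have hne : A.mulVec x ≠ 0 := fun h0 => by simp [h0] at hx
  exact (h.2 _ (mulVec_mem_plantedSubspace v A x) hne).trans (l1LinfRatio_le_l1Norm hx)

end IsProgramMin

end ProgramMin

section Distortion

open Metric Module
open scoped NNReal

variable {n k : ℕ}

lemma exists_finset_isCover_sphere_card_le_exp (E : Type*) [NormedAddCommGroup E]
    [NormedSpace ℝ E] [FiniteDimensional ℝ E] :
    ∃ N : Finset E, ↑N ⊆ sphere (0 : E) 1 ∧ IsCover (1 / 3200) (sphere (0 : E) 1) N ∧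
      (N.card : ℝ) ≤ Real.exp (16 * finrank ℝ E) := by
  obtain ⟨N, hsphere, hcover, hcard⟩ := exists_finset_isCover_card_le (r := 1) (ε := 1 / 3200)
    (by positivity) (sphere_subset_closedBall (x := (0 : E)))
  refine ⟨N, hsphere, hcover, hcard.trans ?_⟩
  have hexp : (1 + 2 * (1 : ℝ≥0) / (1 / 3200 : ℝ≥0) : ℝ) ≤ Real.exp 16 :=
    calc (1 + 2 * (1 : ℝ≥0) / (1 / 3200 : ℝ≥0) : ℝ) ≤ 2 ^ 16 := by norm_num
      _ ≤ Real.exp 1 ^ 16 := by gcongr; linarith [Real.add_one_le_exp 1]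
      _ = Real.exp 16 := by rw [Real.exp_one_pow]; norm_num
  rw [mul_comm (16 : ℝ), Real.exp_nat_mul]
  gcongr

/-- The matrix `A` maps `ℓ₂` to `ℓ₁` with bounded distortion: `‖A x‖₁` is comparable to `n * ‖x‖₂`,
as it is for a typical Gaussian matrix with `n` rows. -/
def HasBoundedDistortion (A : Matrix (Fin n) (Fin k) ℝ) : Prop :=
  ∀ x, n / 400 * ‖x‖ ≤ ‖mulVecL1 A x‖ ∧ ‖mulVecL1 A x‖ ≤ 8 * n * ‖x‖

lemma hasBoundedDistortion_of_isCover_sphere {A : Matrix (Fin n) (Fin k) ℝ}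
    {N : Set (EuclideanSpace ℝ (Fin k))} (hN : IsCover (1 / 3200) (sphere 0 1) N)
    (hA : ∀ y ∈ N, HasGaussianNorms (A.mulVec y)) : HasBoundedDistortion A := by
  have hlower (y) (hy : y ∈ N) : n / 200 ≤ ‖mulVecL1 A y‖ := by
    simpa [norm_mulVecL1, l1Norm] using (hA y hy).lt_sum_abs.le
  have hupper (y) (hy : y ∈ N) : ‖mulVecL1 A y‖ ≤ 4 * n := by
    simpa [norm_mulVecL1, l1Norm] using (hA y hy).sum_abs_le
  have hopNorm : ‖mulVecL1 A‖ ≤ 8 * n := by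
    have h := opNorm_mul_one_sub_le_of_isCover_sphere hN (by positivity) hupper
    push_cast at h
    linarith [norm_nonneg (mulVecL1 A)]
  refine fun x => ⟨?_, (mulVecL1 A).le_of_opNorm_le hopNorm x⟩
  -- The mesh `1 / 3200` costs `8 n / 3200 = n / 400`, half of the lower bound on the net.
  refine le_trans ?_ (mul_norm_le_of_isCover_sphere hN hlower x)
  gcongr
  push_cast
  linarith

lemma HasBoundedDistortion.exists_isProgramMin {A : Matrix (Fin n) (Fin k) ℝ} {i : Fin n}
    (hA : HasBoundedDistortion A) (hrow : HasGaussianNorms (A i)) :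
    ∃ m, IsProgramMin A i m ∧ 1 / 1600 * (n / √k) ≤ m ∧ m ≤ 1600 * (n / √k) := by
  have hn : (0 : ℝ) < n := by exact_mod_cast i.pos
  have hrow0 : A i ≠ 0 := hrow.ne_zero
  have hpos : 0 < ‖WithLp.toLp 2 (A i)‖ := by simpa using hrow0
  have hle : ‖WithLp.toLp 2 (A i)‖ ≤ 4 * √k := by simpa using hrow.norm_toLp_le
  have hge : √k / 200 ≤ ‖WithLp.toLp 2 (A i)‖ := by simpa using hrow.le_norm_toLp
  have hk : 0 < √(k : ℝ) := by linarith
  obtain ⟨m, hm⟩ := SparsestElement.exists_isProgramMin (by positivity) (fun x => (hA x).1) hrow0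
  refine ⟨m, hm, ?_, ?_⟩
  · calc 1 / 1600 * (n / √k) = n / 400 / (4 * √k) := by field_simp; norm_num
      _ ≤ n / 400 / ‖WithLp.toLp 2 (A i)‖ := by gcongr
      _ ≤ m := hm.div_norm_row_le (by positivity) fun x => (hA x).1
  · calc m ≤ 8 * n / ‖WithLp.toLp 2 (A i)‖ := hm.le_div_norm_row hrow0 fun x => (hA x).2
      _ ≤ 8 * n / (√k / 200) := by gcongr
      _ = 1600 * (n / √k) := by field_simp; norm_num

end Distortion

namespace IsStdGaussianMatrix

variable {Ω : Type*} [MeasurableSpace Ω] {μ : Measure Ω} {n k : ℕ}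
  {V : Ω → Matrix (Fin n) (Fin k) ℝ}

lemma measureReal_not_hasBoundedDistortion_le (hV : IsStdGaussianMatrix V μ)
    (hkn : (k : ℝ) ≤ n / 16) :
    μ.real {ω | ¬ HasBoundedDistortion (V ω)} ≤ 2 * Real.exp (-(2 * n)) := by
  have := hV.indep_entries.isProbabilityMeasure
  obtain ⟨N, hsphere, hcover, hcard⟩ :=
    exists_finset_isCover_sphere_card_le_exp (EuclideanSpace ℝ (Fin k))
  rw [finrank_euclideanSpace_fin] at hcard
  have hsub : {ω | ¬ HasBoundedDistortion (V ω)} ⊆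
      ⋃ y ∈ N, {ω | ¬ HasGaussianNorms ((V ω).mulVec y)} := by
    intro ω hω
    by_contra! h
    simp only [Set.mem_iUnion, Set.mem_ofPred_eq, not_exists, not_not] at h
    exact hω (hasBoundedDistortion_of_isCover_sphere hcover h)
  calc μ.real {ω | ¬ HasBoundedDistortion (V ω)}
      ≤ ∑ y ∈ N, μ.real {ω | ¬ HasGaussianNorms ((V ω).mulVec y)} :=
        (measureReal_mono hsub (measure_ne_top _ _)).trans (measureReal_biUnion_finset_le _ _)
    _ ≤ N.card * (2 * Real.exp (-3 * n)) := by
        rw [← nsmul_eq_mul]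
        exact Finset.sum_le_card_nsmul _ _ _ fun y hy =>
          hV.measureReal_not_hasGaussianNorms_mulVec_le (mem_sphere_zero_iff_norm.1 (hsphere hy))
    _ ≤ Real.exp n * (2 * Real.exp (-3 * n)) := by
        gcongr
        exact hcard.trans (Real.exp_le_exp.2 (by linarith))
    _ = 2 * Real.exp (-(2 * n)) := by
        rw [mul_left_comm, ← Real.exp_add]; ring_nf

lemma measureReal_not_exists_isProgramMin_le (hV : IsStdGaussianMatrix V μ)
    (hkn : (k : ℝ) ≤ n / 16) (i : Fin n) :
    μ.real {ω | ¬ ∃ m, IsProgramMin (V ω) i m ∧ 1 / 1600 * (n / √k) ≤ m ∧ m ≤ 1600 * (n / √k)} ≤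
      2 * Real.exp (-(2 * n)) + 2 * Real.exp (-(3 * k)) := by
  have := hV.indep_entries.isProbabilityMeasure
  have hsub : {ω | ¬ ∃ m, IsProgramMin (V ω) i m ∧
      1 / 1600 * (n / √k) ≤ m ∧ m ≤ 1600 * (n / √k)} ⊆
      {ω | ¬ HasBoundedDistortion (V ω)} ∪ {ω | ¬ HasGaussianNorms (V ω i)} := by
    intro ω hω
    by_contra! h
    simp only [Set.mem_union, Set.mem_ofPred_eq, not_or, not_not] at h
    exact hω (h.1.exists_isProgramMin h.2)
  refine (measureReal_mono hsub).trans <| (measureReal_union_le _ _).trans <|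
    add_le_add (hV.measureReal_not_hasBoundedDistortion_le hkn) ?_
  simpa only [neg_mul] using hV.measureReal_not_hasGaussianNorms_row_le i

end IsStdGaussianMatrix

end SparsestElement

theorem mainTheorem3 :
    ∃ c C γ₁ γ₂ γ₃ γ₄ : ℝ, 0 < c ∧ 0 < C ∧ 0 < γ₁ ∧ 0 < γ₂ ∧ 0 < γ₃ ∧ 0 < γ₄ ∧
      ∀ (n k : ℕ), 1 ≤ k → (k : ℝ) ≤ (n : ℝ) / 16 → ∀ (i : Fin n)
        (Ω : Type*) [MeasurableSpace Ω] (μ : Measure Ω) [IsProbabilityMeasure μ]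
        (V : Ω → Matrix (Fin n) (Fin k) ℝ), SparsestElement.IsStdGaussianMatrix V μ →
        μ {ω | ¬ (
            -- the minimum is attained and comparable to `n / √k`
            (∃ m : ℝ, SparsestElement.IsProgramMin (V ω) i m ∧
              c * ((n : ℝ) / Real.sqrt k) ≤ m ∧ m ≤ C * ((n : ℝ) / Real.sqrt k)) ∧
            -- the program normalized at a largest entry of a planted `v` can only recover `v`
            -- below this scaling
            (∀ v : Fin n → ℝ, v ≠ 0 → (∀ l, |v l| ≤ |v i|) →
              SparsestElement.SolvesProgram (SparsestElement.plantedSubspace v (V ω)) i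
                ((v i)⁻¹ • v) →
              SparsestElement.l1LinfRatio v ≤ C * ((n : ℝ) / Real.sqrt k)) ∧
            -- the same for minimization of the ratio `‖z‖₁ / ‖z‖_∞`
            (∀ v : Fin n → ℝ,
              SparsestElement.MinimizesRatio (SparsestElement.plantedSubspace v (V ω)) v →
              SparsestElement.l1LinfRatio v ≤ C * ((n : ℝ) / Real.sqrt k)))}
          ≤ ENNReal.ofReal
              (γ₁ * Real.exp (-(γ₂ * (n : ℝ))) + γ₃ * Real.exp (-(γ₄ * (k : ℝ)))) := by
  refine ⟨1 / 1600, 1600, 2, 2, 2, 3, by norm_num, by norm_num, by norm_num, by norm_num,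
    by norm_num, by norm_num, ?_⟩
  intro n k _ hkn i Ω _ μ _ V hV
  rw [← ofReal_measureReal]
  refine ENNReal.ofReal_le_ofReal <| (measureReal_mono fun ω hω => ?_).trans
    (hV.measureReal_not_exists_isProgramMin_le hkn i)
  rintro ⟨m, hm, hmc, hmC⟩
  exact hω ⟨⟨m, hm, hmc, hmC⟩,
    fun v _ hv h => (hm.l1LinfRatio_le_of_solvesProgram hv h).trans hmC,
    fun v h => (hm.l1LinfRatio_le_of_minimizesRatio h).trans hmC⟩
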